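/- For a finite group $G$ and $n\ge 1$, call two elements of $G$ equivalent if they generate the same cyclic subgroup, and let $\mathfrak m(n)$ be the number of equivalence classes consisting of elements of order $n$ (equivalently, the number of cyclic subgroups of $G$ of order $n$). Let $p$ be a prime and let $G$ be a non-trivial finite $p$-group of exponent $p^e$ (so $e\ge 1$). Then $\mathfrak m(p^i)=1$ for some $1\le i\le e$ if and only if one of the following holds: (i) $G$ is isomorphic to the cyclic group $C_{p^e}$; (ii) $p=2$ and $G$ is isomorphic to one of the following groups: (a) $e\ge 2$ and $G\cong\langle x,y : x^{2^e}=1,\ y^2=1,\ y^{-1}xy=x^{-1}\rangle$, the dihedral group of order $2^{e+1}$; (b) $e\ge 2$ and $G\cong\langle x,y : x^{2^e}=1,\ x^{2^{e-1}}=y^2,\ y^{-1}xy=x^{-1}\rangle$, the generalized quaternion group of order $2^{e+1}$; (c) $e\ge 3$ and $G\cong\langle x,y : x^{2^e}=1,\ y^2=1,\ y^{-1}xy=x^{-1+2^{e-1}}\rangle$, the semidihedral group of order $2^{e+1}$. Moreover, in case (i) $\mathfrak m(p^j)=1$ for all $1\le j\le e$. In case (a) $\mathfrak m(2)=1+2^e$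 and $\mathfrak m(2^j)=1$ for all $2\le j\le e$. In case (b) $\mathfrak m(4)=1+2^{e-1}$ and $\mathfrak m(2^j)=1$ for all $1\le j\le e$ with $j\ne 2$. In case (c) $\mathfrak m(2)=1+2^{e-1}$, $\mathfrak m(4)=1+2^{e-2}$ and $\mathfrak m(2^j)=1$ for all $3\le j\le e$. -/

import Mathlib

/-- Two elements of a group are equivalent when they generate the same cyclic subgroup. -/
def cyclicSetoid (G : Type*) [Group G] : Setoid G where
  r g h := Subgroup.zpowers g = Subgroup.zpowers h
  iseqv := ⟨fun _ => rfl, fun h => h.symm, fun h₁ h₂ => h₁.trans h₂⟩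

/-- The `n`-th cyclic class number of `G`: the number of cyclic classes that contain
elements of order `n`. -/
noncomputable def cyclicClassNumber (G : Type*) [Group G] (n : ℕ) : ℕ :=
  ((Quotient.mk (cyclicSetoid G)) '' {g : G | orderOf g = n}).ncard

/-- The relators `x ^ (2 ^ e)`, `y ^ 2` and `y⁻¹ x y (x ^ (-1 + 2 ^ (e - 1)))⁻¹`
on the two letters `x = of 0` and `y = of 1`. -/
def semidihedralRels (e : ℕ) : Set (FreeGroup (Fin 2)) :=
  let x : FreeGroup (Fin 2) := FreeGroup.of 0
  let y : FreeGroup (Fin 2) := FreeGroup.of 1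
  {x ^ (2 ^ e), y ^ 2, y⁻¹ * x * y * (x ^ (-1 + 2 ^ (e - 1) : ℤ))⁻¹}

/-- The semidihedral `2`-group `⟨x, y : x ^ (2 ^ e) = 1, y ^ 2 = 1, y⁻¹ x y = x ^ (-1 + 2 ^ (e - 1))⟩`
of order `2 ^ (e + 1)`; it is used for `e ≥ 3` only. -/
abbrev SemidihedralGroup (e : ℕ) : Type :=
  PresentedGroup (semidihedralRels e)

/-! Let `⟨c⟩` be the unique cyclic subgroup of order `p ^ i`; it is normal. If `i ≥ 2` and `g ^ p =
1`, where `g` acts on `⟨c⟩` trivially modulo `p` (modulo `4` if `p = 2`), then `g * c` again has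
order `p ^ i`, so `g ∈ ⟨c⟩`. If `i = 1`, a central element of order `p` in `G ⧸ ⟨c⟩` lifts to an
element of order `p ^ 2` that generates a normal subgroup containing every solution of `g ^ p = 1`.
Both cases thus meet the hypotheses of `IsPGroup.isCyclic_or_isCyclicByTwo`.

That criterion rests on one construction: an element normalizing a maximal cyclic subgroup `⟨x⟩`
from outside can be corrected by a power of `x` to an element of order `p`, still outside, unless `p
= 2` and the action modulo `4` is nontrivial. Hence the centralizer of `c` is a cyclic group `⟨x⟩`,
and either it is all of `G`, or `p = 2`, it has index two and elements outside it invert its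
elements of order `4`.

In the latter case `G` is determined by `v` and `k` in `y⁻¹ x y = x ^ v`, `y ^ 2 = x ^ k`. Both `2k`
and `2(v + 1)` vanish modulo `2 ^ n`, which leaves the three families. Their class numbers follow by
counting elements outside `⟨x⟩`, all of order `2` or `4`. -/

/-! ### Extensions of a cyclic group by a group of order two, through structure constants -/

/-- `y` normalizes the cyclic subgroup generated by `x`, which has index two and order `N`, acting
on it by `x ↦ x ^ v`, and `y ^ 2 = x ^ k`. -/
structure IsCyclicByTwo {G : Type*} [Group G] (x y : G) (N : ℕ) (v k : ℤ) : Prop where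
  orderOf_eq : orderOf x = N
  notMem : y ∉ Subgroup.zpowers x
  exists_eq : ∀ g : G, ∃ a : ℤ, g = x ^ a ∨ g = y * x ^ a
  conj : y⁻¹ * x * y = x ^ v
  sq : y ^ 2 = x ^ k

theorem conj_zpow_eq {G : Type*} [Group G] {x y : G} {v : ℤ} (h : y⁻¹ * x * y = x ^ v) (a : ℤ) :
    y⁻¹ * x ^ a * y = x ^ (v * a) := by
  rw [zpow_mul, ← h]
  simpa using (conj_zpow (i := a) (a := y⁻¹) (b := x)).symm

namespace IsCyclicByTwo

variable {G : Type*} [Group G] {x y : G} {N : ℕ} {v k : ℤ}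

theorem zpow_mul_eq (h : IsCyclicByTwo x y N v k) (a : ℤ) : x ^ a * y = y * x ^ (v * a) := by
  rw [← conj_zpow_eq h.conj]; group

theorem zpow_eq_one_iff (h : IsCyclicByTwo x y N v k) (a : ℤ) : x ^ a = 1 ↔ (N : ℤ) ∣ a := by
  rw [← orderOf_dvd_iff_zpow_eq_one, h.orderOf_eq]

theorem zpow_eq_iff (h : IsCyclicByTwo x y N v k) (a b : ℤ) :
    x ^ a = x ^ b ↔ a ≡ b [ZMOD N] := by
  rw [zpow_eq_zpow_iff_modEq, h.orderOf_eq]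

theorem mul_zpow_notMem (h : IsCyclicByTwo x y N v k) (a : ℤ) :
    y * x ^ a ∉ Subgroup.zpowers x := fun hm =>
  h.notMem ((Subgroup.mul_mem_cancel_right _ (Subgroup.zpow_mem_zpowers x a)).1 hm)

theorem mul_zpow_mul_mul_zpow (h : IsCyclicByTwo x y N v k) (a b : ℤ) :
    (y * x ^ a) * (y * x ^ b) = x ^ (k + v * a + b) := by
  rw [show y * x ^ a * (y * x ^ b) = y * (x ^ a * y) * x ^ b by group, h.zpow_mul_eq,
    show y * (y * x ^ (v * a)) * x ^ b = y ^ 2 * (x ^ (v * a) * x ^ b) by rw [pow_two]; group, h.sq,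
    zpow_add, zpow_add, mul_assoc]

theorem map {G' : Type*} [Group G'] (f : G ≃* G') (h : IsCyclicByTwo x y N v k) :
    IsCyclicByTwo (f x) (f y) N v k where
  orderOf_eq := by rw [← h.orderOf_eq]; exact orderOf_injective f.toMonoidHom f.injective x
  notMem := by
    rintro ⟨a, ha⟩
    refine h.notMem ⟨a, f.injective ?_⟩
    simpa using ha
  exists_eq g := by
    obtain ⟨a, ha⟩ := h.exists_eq (f.symm g)
    refine ⟨a, ha.imp ?_ ?_⟩ <;> intro e <;> rw [MulEquiv.symm_apply_eq] at e <;> simpa using e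
  conj := by rw [← map_zpow, ← h.conj]; simp
  sq := by rw [← map_zpow, ← h.sq]; simp

theorem of_modEq (h : IsCyclicByTwo x y N v k) {v' k' : ℤ} (hv : v ≡ v' [ZMOD N])
    (hk : k ≡ k' [ZMOD N]) : IsCyclicByTwo x y N v' k' where
  orderOf_eq := h.orderOf_eq
  notMem := h.notMem
  exists_eq := h.exists_eq
  conj := by rw [h.conj, h.zpow_eq_iff]; exact hv
  sq := by rw [h.sq, h.zpow_eq_iff]; exact hk

/-- The graph of the isomorphism between two groups with the same structure constants. -/
def graph {G' : Type*} [Group G'] {x' y' : G'} (h : IsCyclicByTwo x y N v k)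
    (h' : IsCyclicByTwo x' y' N v k) : Subgroup (G × G') where
  carrier := {q | ∃ a : ℤ, q = (x ^ a, x' ^ a) ∨ q = (y * x ^ a, y' * x' ^ a)}
  one_mem' := ⟨0, Or.inl (by rw [zpow_zero, zpow_zero]; rfl)⟩
  mul_mem' := by
    rintro _ _ ⟨a, rfl | rfl⟩ ⟨b, rfl | rfl⟩
    · exact ⟨a + b, Or.inl (by simp [zpow_add])⟩
    · refine ⟨v * a + b, Or.inr ?_⟩
      simp only [Prod.mk_mul_mk, ← mul_assoc, h.zpow_mul_eq, h'.zpow_mul_eq, zpow_add]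
    · exact ⟨a + b, Or.inr (by simp [zpow_add, mul_assoc])⟩
    · refine ⟨k + v * a + b, Or.inl ?_⟩
      rw [Prod.mk_mul_mk, h.mul_zpow_mul_mul_zpow, h'.mul_zpow_mul_mul_zpow]
  inv_mem' := by
    rintro _ ⟨a, rfl | rfl⟩
    · exact ⟨-a, Or.inl (by simp)⟩
    · refine ⟨-(k + v * a), Or.inr ?_⟩
      rw [Prod.inv_mk, Prod.mk.injEq, inv_eq_iff_mul_eq_one, inv_eq_iff_mul_eq_one,
        h.mul_zpow_mul_mul_zpow, h'.mul_zpow_mul_mul_zpow]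
      simp

/-- Exponents are only defined modulo `N`, so instead of choosing them one shows that both
projections of the graph are bijective. -/
theorem nonempty_mulEquiv {G' : Type*} [Group G'] {x' y' : G'} (h : IsCyclicByTwo x y N v k)
    (h' : IsCyclicByTwo x' y' N v k) : Nonempty (G ≃* G') := by
  have h1 : Function.Bijective ((MonoidHom.fst G G').comp (graph h h').subtype) := by
    constructor
    · rw [injective_iff_map_eq_one]
      rintro ⟨_, a, rfl | rfl⟩ e
      · have e' : x ^ a = 1 := e
        have e2 : x' ^ a = 1 := by rwa [h'.zpow_eq_one_iff, ← h.zpow_eq_one_iff]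
        ext <;> simp [e', e2]
      · have e' : y * x ^ a = 1 := e
        exact absurd (e' ▸ Subgroup.one_mem _) (h.mul_zpow_notMem a)
    · intro g
      obtain ⟨a, rfl | rfl⟩ := h.exists_eq g
      · exact ⟨⟨_, a, Or.inl rfl⟩, rfl⟩
      · exact ⟨⟨_, a, Or.inr rfl⟩, rfl⟩
  have h2 : Function.Bijective ((MonoidHom.snd G G').comp (graph h h').subtype) := by
    constructor
    · rw [injective_iff_map_eq_one]
      rintro ⟨_, a, rfl | rfl⟩ e
      · have e' : x' ^ a = 1 := e
        have e2 : x ^ a = 1 := by rwa [h.zpow_eq_one_iff, ← h'.zpow_eq_one_iff]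
        ext <;> simp [e', e2]
      · have e' : y' * x' ^ a = 1 := e
        exact absurd (e' ▸ Subgroup.one_mem _) (h'.mul_zpow_notMem a)
    · intro g
      obtain ⟨a, rfl | rfl⟩ := h'.exists_eq g
      · exact ⟨⟨_, a, Or.inl rfl⟩, rfl⟩
      · exact ⟨⟨_, a, Or.inr rfl⟩, rfl⟩
  exact ⟨(MulEquiv.ofBijective _ h1).symm.trans (MulEquiv.ofBijective _ h2)⟩

end IsCyclicByTwo

/-! ### Structure constants of the three families -/

theorem DihedralGroup.isCyclicByTwo (n : ℕ) :
    IsCyclicByTwo (DihedralGroup.r 1 : DihedralGroup n) (DihedralGroup.sr 0) n (-1) 0 where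
  orderOf_eq := DihedralGroup.orderOf_r_one
  notMem := by
    rintro ⟨a, ha⟩
    simp at ha
  exists_eq g := by
    rcases g with i | i <;> obtain ⟨a, rfl⟩ := ZMod.intCast_surjective i <;> exact ⟨a, by simp⟩
  conj := by simp
  sq := by simp [pow_two, ← DihedralGroup.r_zero]

theorem QuaternionGroup.a_one_zpow {n : ℕ} (k : ℤ) :
    (QuaternionGroup.a 1 : QuaternionGroup n) ^ k = QuaternionGroup.a k := by
  cases k with
  | ofNat m => simp [QuaternionGroup.a_one_pow]
  | negSucc m =>
    rw [zpow_negSucc, QuaternionGroup.a_one_pow, inv_eq_iff_mul_eq_one, QuaternionGroup.a_mul_a]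
    simp [← QuaternionGroup.a_zero]

theorem QuaternionGroup.isCyclicByTwo (n : ℕ) :
    IsCyclicByTwo (QuaternionGroup.a 1 : QuaternionGroup n) (QuaternionGroup.xa 0)
      (2 * n) (-1) n where
  orderOf_eq := QuaternionGroup.orderOf_a_one
  notMem := by
    rintro ⟨a, ha⟩
    simp [QuaternionGroup.a_one_zpow] at ha
  exists_eq g := by
    rcases g with i | i <;> obtain ⟨a, rfl⟩ := ZMod.intCast_surjective i <;>
      exact ⟨a, by simp [QuaternionGroup.a_one_zpow]⟩
  conj := by
    rw [mul_assoc, inv_mul_eq_iff_eq_mul, QuaternionGroup.a_one_zpow]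
    simp
  sq := by rw [QuaternionGroup.a_one_zpow]; simp [pow_two]

namespace SemidihedralGroup

/-- The generator `x` of the semidihedral group. -/
def x (e : ℕ) : SemidihedralGroup e := PresentedGroup.of 0

/-- The generator `y` of the semidihedral group. -/
def y (e : ℕ) : SemidihedralGroup e := PresentedGroup.of 1

variable (e : ℕ)

theorem x_pow : x e ^ 2 ^ e = 1 :=
  PresentedGroup.one_of_mem (rels := semidihedralRels e) (x := FreeGroup.of 0 ^ 2 ^ e)
    (by simp [semidihedralRels])

theorem y_pow : y e ^ 2 = 1 :=
  PresentedGroup.one_of_mem (rels := semidihedralRels e) (x := FreeGroup.of 1 ^ 2)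
    (by simp [semidihedralRels])

theorem conj : (y e)⁻¹ * x e * y e = x e ^ (-1 + 2 ^ (e - 1) : ℤ) := by
  rw [← mul_inv_eq_one]
  exact PresentedGroup.one_of_mem (rels := semidihedralRels e)
    (x := (FreeGroup.of 1)⁻¹ * FreeGroup.of 0 * FreeGroup.of 1 *
      (FreeGroup.of 0 ^ (-1 + 2 ^ (e - 1) : ℤ))⁻¹) (by simp [semidihedralRels])

theorem exists_eq (g : SemidihedralGroup e) : ∃ a : ℤ, g = x e ^ a ∨ g = y e * x e ^ a := by
  have hc (a : ℤ) : x e ^ a * y e = y e * x e ^ ((-1 + 2 ^ (e - 1) : ℤ) * a) := by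
    rw [← conj_zpow_eq (conj e)]; group
  have hy : (y e)⁻¹ = y e := by rw [inv_eq_iff_mul_eq_one, ← pow_two, y_pow]
  have hg : g ∈ Subgroup.closure (Set.range (PresentedGroup.of (rels := semidihedralRels e))) := by
    rw [PresentedGroup.closure_range_of]; trivial
  have key (z : SemidihedralGroup e) (hz : ∃ a : ℤ, z = x e ^ a ∨ z = y e * x e ^ a) :
      ∃ a : ℤ, z * y e = x e ^ a ∨ z * y e = y e * x e ^ a := by
    obtain ⟨a, rfl | rfl⟩ := hz
    · exact ⟨_, Or.inr (hc a)⟩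
    · refine ⟨(-1 + 2 ^ (e - 1) : ℤ) * a, Or.inl ?_⟩
      rw [mul_assoc, hc, ← mul_assoc, ← pow_two, y_pow, one_mul]
  induction hg using Subgroup.closure_induction_right with
  | one => exact ⟨0, by simp⟩
  | mul_right z _ w hw ih =>
    obtain ⟨i, rfl⟩ := hw
    fin_cases i
    · obtain ⟨a, rfl | rfl⟩ := ih
      · exact ⟨a + 1, Or.inl (by rw [zpow_add, zpow_one]; rfl)⟩
      · exact ⟨a + 1, Or.inr (by rw [zpow_add, zpow_one, ← mul_assoc]; rfl)⟩
    · exact key z ih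
  | mul_inv_cancel z _ w hw ih =>
    obtain ⟨i, rfl⟩ := hw
    fin_cases i
    · obtain ⟨a, rfl | rfl⟩ := ih
      · exact ⟨a + -1, Or.inl (by rw [zpow_add, zpow_neg_one]; rfl)⟩
      · exact ⟨a + -1, Or.inr (by rw [zpow_add, zpow_neg_one, ← mul_assoc]; rfl)⟩
    · have := key z ih
      change ∃ a : ℤ, z * (y e)⁻¹ = _ ∨ z * (y e)⁻¹ = _
      rw [hy]; exact this

theorem unit_sq (he : 3 ≤ e) :
    ((-1 + 2 ^ (e - 1) : ℤ) : ZMod (2 ^ e)) * ((-1 + 2 ^ (e - 1) : ℤ) : ZMod (2 ^ e)) = 1 := by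
  obtain ⟨f, rfl⟩ : ∃ f, e = f + 3 := ⟨e - 3, by omega⟩
  have h : ((2 ^ (f + 3) : ℤ) : ZMod (2 ^ (f + 3))) = 0 := by
    have := ZMod.natCast_self (2 ^ (f + 3)); push_cast at this ⊢; exact this
  have : ((-1 + 2 ^ (f + 3 - 1)) * (-1 + 2 ^ (f + 3 - 1)) : ℤ) =
      1 + 2 ^ (f + 3) * (-1 + 2 ^ (f + 1)) := by
    simp only [Nat.add_succ_sub_one]; ring
  rw [← Int.cast_mul, this, Int.cast_add, Int.cast_mul, h]; simp

/-- The semidihedral group acts on `ℤ / 2 ^ e` by affine maps. -/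
theorem exists_hom (he : 3 ≤ e) : ∃ f : SemidihedralGroup e →* Equiv.Perm (ZMod (2 ^ e)),
    (∀ t, f (x e) t = t + 1) ∧ ∀ t, f (y e) t = ((-1 + 2 ^ (e - 1) : ℤ) : ZMod (2 ^ e)) * t := by
  set w : ZMod (2 ^ e) := ((-1 + 2 ^ (e - 1) : ℤ) : ZMod (2 ^ e)) with hw
  have hww : w * w = 1 := unit_sq e he
  let X : Equiv.Perm (ZMod (2 ^ e)) := Equiv.addRight 1
  let Y : Equiv.Perm (ZMod (2 ^ e)) :=
    ⟨fun t => w * t, fun t => w * t, fun t => by simp [← mul_assoc, hww],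
      fun t => by simp [← mul_assoc, hww]⟩
  have hX (a : ℤ) (t : ZMod (2 ^ e)) : (X ^ a) t = t + a := by
    simp [X]
  have hY (t : ZMod (2 ^ e)) : Y t = w * t := rfl
  have hY' : Y⁻¹ = Y := by
    rw [inv_eq_iff_mul_eq_one]; ext t; simp [hY, ← mul_assoc, hww]
  refine ⟨PresentedGroup.toGroup (f := ![X, Y]) ?_, ?_, ?_⟩
  · intro r hr
    simp only [semidihedralRels, Set.mem_insert_iff, Set.mem_singleton_iff] at hr
    rcases hr with rfl | rfl | rfl
    · ext t
      have := hX (2 ^ e : ℕ) t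
      rw [zpow_natCast] at this
      simp [this]
      have := ZMod.natCast_self (2 ^ e); push_cast at this; exact this
    · simp only [map_pow, FreeGroup.lift_apply_of]
      change Y ^ 2 = 1
      rw [pow_two]
      nth_rw 1 [← hY']
      simp
    · simp only [map_mul, map_inv, map_zpow, FreeGroup.lift_apply_of]
      change Y⁻¹ * X * Y * (X ^ (-1 + 2 ^ (e - 1) : ℤ))⁻¹ = 1
      rw [mul_inv_eq_one, hY']
      ext t
      rw [hX, ← hw]
      have : X (w * t) = w * t + 1 := rfl
      simp [hY, this, mul_add, ← mul_assoc, hww]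
  · intro t
    simp [x, X]
  · intro t
    simp [y, hY]

/-- The relations give normal forms; the affine action shows that the presentation does not collapse
further. -/
theorem isCyclicByTwo (he : 3 ≤ e) :
    IsCyclicByTwo (x e) (y e) (2 ^ e) (-1 + 2 ^ (e - 1)) 0 := by
  obtain ⟨f, hx, hy⟩ := exists_hom e he
  have hX (a : ℤ) : (f (x e ^ a)) 0 = a := by
    have : f (x e) = Equiv.addRight 1 := Equiv.ext hx
    simp [this]
  refine ⟨?_, ?_, exists_eq e, conj e, by rw [y_pow, zpow_zero]⟩
  · refine Nat.dvd_antisymm (orderOf_dvd_of_pow_eq_one (x_pow e)) ?_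
    have := hX (orderOf (x e))
    rw [zpow_natCast, pow_orderOf_eq_one] at this
    rw [← ZMod.natCast_eq_zero_iff]
    simpa using this.symm
  · rintro ⟨a, ha⟩
    -- Evaluating at `0` forces `y = 1`; evaluating at `1` then gives `2 ^ (e - 1) ≡ 2` modulo `2 ^
    -- e`, which fails modulo `4` since `e ≥ 3`.
    have ha' : x e ^ a = y e := ha
    have h0 := hX a
    rw [ha', hy, mul_zero] at h0
    have hd : ((2 ^ e : ℕ) : ℤ) ∣ a := by rw [← CharP.intCast_eq_zero_iff (ZMod (2 ^ e)) (2 ^ e), ← h0]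
    have h1 : y e = 1 := by
      rw [← ha', ← orderOf_dvd_iff_zpow_eq_one]
      exact (Int.natCast_dvd_natCast.2 (orderOf_dvd_of_pow_eq_one (x_pow e))).trans hd
    have h2 := hy 1
    rw [h1, MonoidHom.map_one, Equiv.Perm.one_apply, mul_one] at h2
    have h3 : ((2 ^ e : ℕ) : ℤ) ∣ (-1 + 2 ^ (e - 1)) - 1 := by
      rw [← CharP.intCast_eq_zero_iff (ZMod (2 ^ e)) (2 ^ e)]; push_cast at h2 ⊢; rw [← h2]; simp
    have h4 : (4 : ℤ) ∣ (2 ^ e : ℕ) := by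
      push_cast; exact (pow_dvd_pow 2 (show 2 ≤ e by omega) : (2 : ℤ) ^ 2 ∣ _)
    have h5 : (4 : ℤ) ∣ 2 ^ (e - 1) := (pow_dvd_pow 2 (show 2 ≤ e - 1 by omega) : (2 : ℤ) ^ 2 ∣ _)
    have := h4.trans h3
    omega

end SemidihedralGroup

/-! ### Counting cyclic subgroups by counting elements -/

theorem ncard_setOf_zpowers_eq {G : Type*} [Group G] [Finite G] (H : Subgroup G) [IsCyclic H]
    {n : ℕ} (hn : n ∣ Nat.card H) : {g : G | g ∈ H ∧ orderOf g = n}.ncard = n.totient := by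
  classical
  have := Fintype.ofFinite H
  rw [← IsCyclic.card_orderOf_eq_totient (α := H) (d := n) (by rwa [← Nat.card_eq_fintype_card]),
    ← Set.ncard_coe_finset, ← Set.ncard_image_of_injective _ (Subtype.val_injective (p := (· ∈ H)))]
  congr 1
  ext g
  simp [and_comm]

/-- The fibre over each class is the set of generators of one cyclic group of order `n`. -/
theorem ncard_orderOf_eq {G : Type*} [Group G] [Finite G] (n : ℕ) :
    {g : G | orderOf g = n}.ncard = n.totient * cyclicClassNumber G n := by
  classical
  have := Fintype.ofFinite G
  have hfin : ((Quotient.mk (cyclicSetoid G)) '' {g : G | orderOf g = n}).Finite := Set.toFinite _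
  rw [cyclicClassNumber, Set.ncard_eq_toFinset_card' {g : G | orderOf g = n},
    Set.ncard_eq_toFinset_card _ hfin]
  rw [Finset.card_eq_sum_card_fiberwise (f := Quotient.mk (cyclicSetoid G)) (t := hfin.toFinset)]
  · rw [Finset.sum_const_nat (m := n.totient), mul_comm]
    intro q hq
    simp only [Set.Finite.mem_toFinset, Set.mem_image, Set.mem_ofPred_eq] at hq
    obtain ⟨g, rfl, rfl⟩ := hq
    rw [← ncard_setOf_zpowers_eq (Subgroup.zpowers g) (n := orderOf g) (by rw [Nat.card_zpowers]),
      ← Set.ncard_coe_finset]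
    congr 1
    ext h
    simp only [Finset.coe_filter, Set.mem_toFinset, Set.mem_ofPred_eq]
    constructor
    · rintro ⟨h1, h2⟩
      have h3 : Subgroup.zpowers h = Subgroup.zpowers g := Quotient.exact h2
      exact ⟨h3 ▸ Subgroup.mem_zpowers h, h1⟩
    · rintro ⟨h1, h2⟩
      refine ⟨h2, Quotient.sound ?_⟩
      exact Subgroup.eq_of_le_of_card_ge (Subgroup.zpowers_le.2 h1)
        (by rw [Nat.card_zpowers, Nat.card_zpowers, h2])
  · intro g hg
    simp only [Set.coe_toFinset, Set.mem_ofPred_eq] at hg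
    simp only [Set.Finite.coe_toFinset]
    exact ⟨g, hg, rfl⟩

theorem cyclicClassNumber_eq_one_of_ncard {G : Type*} [Group G] [Finite G] {n : ℕ} (hn : 0 < n)
    (h : {g : G | orderOf g = n}.ncard = n.totient) : cyclicClassNumber G n = 1 := by
  rw [ncard_orderOf_eq] at h
  exact Nat.eq_of_mul_eq_mul_left (Nat.totient_pos.2 hn) (by rw [h, mul_one])

theorem cyclicClassNumber_eq_one_of_isCyclic {G : Type*} [Group G] [Finite G] [IsCyclic G] {n : ℕ}
    (hn : n ∣ Nat.card G) : cyclicClassNumber G n = 1 := by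
  refine cyclicClassNumber_eq_one_of_ncard (Nat.pos_of_dvd_of_pos hn Nat.card_pos) ?_
  have : IsCyclic (⊤ : Subgroup G) := Subgroup.isCyclic _
  simpa using ncard_setOf_zpowers_eq (⊤ : Subgroup G) (n := n) (by simpa using hn)

theorem exists_unique_zpowers_of_cyclicClassNumber_eq_one {G : Type*} [Group G] {n : ℕ}
    (h : cyclicClassNumber G n = 1) :
    ∃ c : G, orderOf c = n ∧ ∀ g : G, orderOf g = n → Subgroup.zpowers g = Subgroup.zpowers c := by
  obtain ⟨q, hq⟩ := Set.ncard_eq_one.1 h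
  obtain ⟨c, hc, rfl⟩ : q ∈ (Quotient.mk (cyclicSetoid G)) '' {g : G | orderOf g = n} := by
    rw [hq]; rfl
  refine ⟨c, hc, fun g hg => ?_⟩
  have : Quotient.mk (cyclicSetoid G) g ∈
    (Quotient.mk (cyclicSetoid G)) '' {g : G | orderOf g = n} := ⟨g, hg, rfl⟩
  rw [hq] at this
  exact Quotient.exact this

/-! ### Class numbers of the three families -/

namespace IsCyclicByTwo

variable {G : Type*} [Group G] {x y : G} {N : ℕ} {v k : ℤ}

theorem orderOf_mul_zpow_eq_two (h : IsCyclicByTwo x y N v k) (a : ℤ) :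
    orderOf (y * x ^ a) = 2 ↔ (N : ℤ) ∣ k + (v + 1) * a := by
  rw [← h.zpow_eq_one_iff, show k + (v + 1) * a = k + v * a + a by ring,
    ← h.mul_zpow_mul_mul_zpow, ← pow_two, orderOf_eq_prime_iff]
  exact and_iff_left fun e => h.mul_zpow_notMem a (e ▸ Subgroup.one_mem _)

theorem mul_zpow_pow_four (h : IsCyclicByTwo x y N v k) (hk : (N : ℤ) ∣ 2 * k)
    (hv : (N : ℤ) ∣ 2 * (v + 1)) (a : ℤ) : (y * x ^ a) ^ 4 = 1 := by
  rw [show 4 = 2 * 2 from rfl, pow_mul, pow_two (y * x ^ a), h.mul_zpow_mul_mul_zpow, pow_two,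
    ← zpow_add, h.zpow_eq_one_iff]
  rw [show (k + v * a + a) + (k + v * a + a) = 2 * k + 2 * (v + 1) * a by ring]
  exact dvd_add hk (hv.mul_right a)

/-- The square of `y * x ^ a` is `x ^ (k + (v + 1) * a)`, whose own square is trivial under `hk` and
`hv`. So only the class numbers at `2` and `4` see elements outside `⟨x⟩`. -/
theorem orderOf_mul_zpow (h : IsCyclicByTwo x y N v k) (hk : (N : ℤ) ∣ 2 * k)
    (hv : (N : ℤ) ∣ 2 * (v + 1)) (a : ℤ) :
    orderOf (y * x ^ a) = 2 ∨ orderOf (y * x ^ a) = 4 := by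
  have h1 : orderOf (y * x ^ a) ∣ 2 ^ 2 :=
    orderOf_dvd_of_pow_eq_one (h.mul_zpow_pow_four hk hv a)
  obtain ⟨i, hi, e⟩ := (Nat.dvd_prime_pow Nat.prime_two).1 h1
  interval_cases i
  · rw [pow_zero, orderOf_eq_one_iff] at e
    exact absurd (e ▸ Subgroup.one_mem _) (h.mul_zpow_notMem a)
  · exact Or.inl e
  · exact Or.inr e

theorem exponent_eq (h : IsCyclicByTwo x y N v k) (hN : 4 ∣ N) (hk : (N : ℤ) ∣ 2 * k)
    (hv : (N : ℤ) ∣ 2 * (v + 1)) : Monoid.exponent G = N := by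
  refine Nat.dvd_antisymm (Monoid.exponent_dvd_of_forall_pow_eq_one fun g => ?_) ?_
  · obtain ⟨a, rfl | rfl⟩ := h.exists_eq g
    · rw [← zpow_natCast, ← zpow_mul, h.zpow_eq_one_iff]; exact Dvd.intro_left a rfl
    · obtain ⟨m, rfl⟩ := hN
      rw [pow_mul, h.mul_zpow_pow_four hk hv, one_pow]
  · rw [← h.orderOf_eq]; exact Monoid.order_dvd_exponent x

theorem ncard_notMem (h : IsCyclicByTwo x y N v k) (hN : 0 < N) (m : ℕ) :
    {g : G | g ∉ Subgroup.zpowers x ∧ orderOf g = m}.ncard =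
      ((Finset.range N).filter fun a : ℕ => orderOf (y * x ^ (a : ℤ)) = m).card := by
  rw [← Set.ncard_coe_finset]
  have hinj : Set.InjOn (fun a : ℕ => y * x ^ (a : ℤ))
      ((Finset.range N).filter fun a : ℕ => orderOf (y * x ^ (a : ℤ)) = m : Finset ℕ) := by
    intro a ha b hb e
    simp only [Finset.coe_filter, Finset.mem_range, Set.mem_ofPred_eq] at ha hb
    have e' := (h.zpow_eq_iff _ _).1 (mul_left_cancel e)
    have := (Int.natCast_modEq_iff.1 e')
    exact Nat.ModEq.eq_of_lt_of_lt this ha.1 hb.1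
  rw [← hinj.ncard_image]
  congr 1
  ext g
  simp only [Set.mem_ofPred_eq, Finset.coe_filter, Finset.mem_range, Set.mem_image]
  constructor
  · rintro ⟨h1, h2⟩
    obtain ⟨a, rfl | rfl⟩ := h.exists_eq g
    · exact absurd (Subgroup.zpow_mem_zpowers x a) h1
    · have hN' : (0 : ℤ) < N := by exact_mod_cast hN
      have h3 : ((a % N).toNat : ℤ) = a % N := Int.toNat_of_nonneg (Int.emod_nonneg _ hN'.ne')
      have h4 : y * x ^ ((a % N).toNat : ℤ) = y * x ^ a := by
        rw [h3, mul_right_inj, h.zpow_eq_iff]; exact Int.mod_modEq a N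
      have h5 := Int.emod_lt_of_pos a hN'
      exact ⟨(a % N).toNat, ⟨by omega, by rw [h4, h2]⟩, h4⟩
  · rintro ⟨a, ⟨-, h2⟩, rfl⟩
    exact ⟨h.mul_zpow_notMem a, h2⟩

theorem ncard_orderOf [Finite G] (h : IsCyclicByTwo x y N v k) {m : ℕ} (hm : m ∣ N) :
    {g : G | orderOf g = m}.ncard = m.totient +
      ((Finset.range N).filter fun a : ℕ => orderOf (y * x ^ (a : ℤ)) = m).card := by
  have hN : 0 < N := h.orderOf_eq ▸ orderOf_pos x
  rw [← h.ncard_notMem hN, ← ncard_setOf_zpowers_eq (Subgroup.zpowers x) (n := m)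
    (by rwa [Nat.card_zpowers, h.orderOf_eq]), ← Set.ncard_union_eq]
  · congr 1
    ext g
    simp only [Set.mem_ofPred_eq, Set.mem_union]
    tauto
  · rw [Set.disjoint_left]
    rintro g ⟨h1, -⟩ ⟨h2, -⟩
    exact h2 h1

theorem cyclicClassNumber_two [Finite G] (h : IsCyclicByTwo x y N v k) (hN : 2 ∣ N) :
    cyclicClassNumber G 2 =
      1 + ((Finset.range N).filter fun a : ℕ => (N : ℤ) ∣ k + (v + 1) * a).card := by
  have := h.ncard_orderOf hN
  rw [ncard_orderOf_eq, Nat.totient_two, one_mul] at this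
  rw [this]
  congr 2
  ext a
  simp only [Finset.mem_filter, h.orderOf_mul_zpow_eq_two]

theorem cyclicClassNumber_four [Finite G] (h : IsCyclicByTwo x y N v k) (hN : 4 ∣ N)
    (hk : (N : ℤ) ∣ 2 * k) (hv : (N : ℤ) ∣ 2 * (v + 1)) :
    2 * cyclicClassNumber G 4 =
      2 + ((Finset.range N).filter fun a : ℕ => ¬ (N : ℤ) ∣ k + (v + 1) * a).card := by
  have := h.ncard_orderOf hN
  rw [ncard_orderOf_eq, show Nat.totient 4 = 2 from rfl] at this
  rw [this]
  congr 2
  ext a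
  simp only [Finset.mem_filter, ← h.orderOf_mul_zpow_eq_two]
  have := h.orderOf_mul_zpow hk hv a
  refine and_congr_right fun _ => ?_
  omega

theorem cyclicClassNumber_eq_one [Finite G] (h : IsCyclicByTwo x y N v k) {m : ℕ} (hm : m ∣ N)
    (hk : (N : ℤ) ∣ 2 * k) (hv : (N : ℤ) ∣ 2 * (v + 1)) (h2 : m ≠ 2) (h4 : m ≠ 4) :
    cyclicClassNumber G m = 1 := by
  have hN : 0 < N := h.orderOf_eq ▸ orderOf_pos x
  refine cyclicClassNumber_eq_one_of_ncard (Nat.pos_of_dvd_of_pos hm hN) ?_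
  rw [h.ncard_orderOf hm, Finset.filter_false_of_mem, Finset.card_empty, add_zero]
  intro a _ e
  have := h.orderOf_mul_zpow hk hv a
  omega

end IsCyclicByTwo

theorem two_pow_ne_two {j : ℕ} (hj : j ≠ 1) : 2 ^ j ≠ 2 := fun h =>
  hj (Nat.pow_right_injective le_rfl (h.trans (pow_one 2).symm))

theorem two_pow_ne_four {j : ℕ} (hj : j ≠ 2) : 2 ^ j ≠ 4 := fun h =>
  hj (Nat.pow_right_injective le_rfl (h.trans (show 4 = 2 ^ 2 from rfl)))

theorem cyclicClassNumber_dihedral {G : Type*} [Group G] [Finite G] {e : ℕ} (he : 2 ≤ e)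
    (f : G ≃* DihedralGroup (2 ^ e)) : cyclicClassNumber G 2 = 1 + 2 ^ e ∧
      ∀ j, 2 ≤ j → j ≤ e → cyclicClassNumber G (2 ^ j) = 1 := by
  have h := (DihedralGroup.isCyclicByTwo (2 ^ e)).map f.symm
  have h4 : 4 ∣ 2 ^ e := pow_dvd_pow 2 he
  refine ⟨?_, fun j hj hje => ?_⟩
  · rw [h.cyclicClassNumber_two (dvd_trans (by norm_num) h4)]
    simp
  · by_cases hj2 : j = 2
    · subst hj2
      have := h.cyclicClassNumber_four h4 (by simp) (by simp)
      simp at this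
      exact this
    · exact h.cyclicClassNumber_eq_one (pow_dvd_pow 2 hje) (by simp) (by simp)
        (two_pow_ne_two (by omega)) (two_pow_ne_four hj2)

theorem cyclicClassNumber_quaternion {G : Type*} [Group G] [Finite G] {e : ℕ} (he : 2 ≤ e)
    (f : G ≃* QuaternionGroup (2 ^ (e - 1))) : cyclicClassNumber G 4 = 1 + 2 ^ (e - 1) ∧
      ∀ j, 1 ≤ j → j ≤ e → j ≠ 2 → cyclicClassNumber G (2 ^ j) = 1 := by
  obtain ⟨d, rfl⟩ : ∃ d, e = d + 1 := ⟨e - 1, by omega⟩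
  rw [Nat.add_sub_cancel] at f ⊢
  have h := (QuaternionGroup.isCyclicByTwo (2 ^ d)).map f.symm
  have h4 : 4 ∣ 2 * 2 ^ d := by rw [← pow_succ']; exact pow_dvd_pow 2 he
  have hk : ((2 * 2 ^ d : ℕ) : ℤ) ∣ 2 * ((2 ^ d : ℕ) : ℤ) := by push_cast; rfl
  have hne : ¬ ((2 * 2 ^ d : ℕ) : ℤ) ∣ ((2 ^ d : ℕ) : ℤ) := by
    intro hd
    have := Nat.le_of_dvd (by positivity) (Int.natCast_dvd_natCast.1 hd)
    have : 0 < 2 ^ d := by positivity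
    omega
  refine ⟨?_, fun j hj hje hj2 => ?_⟩
  · have := h.cyclicClassNumber_four h4 hk (by simp)
    rw [Finset.filter_true_of_mem (fun a _ => by simpa using hne), Finset.card_range] at this
    omega
  · by_cases hj1 : j = 1
    · subst hj1
      rw [pow_one, h.cyclicClassNumber_two (dvd_trans (by norm_num) h4),
        Finset.filter_false_of_mem (fun a _ => by simpa using hne)]
      rfl
    · exact h.cyclicClassNumber_eq_one (by rw [← pow_succ']; exact pow_dvd_pow 2 hje) hk (by simp)
        (two_pow_ne_two hj1) (two_pow_ne_four hj2)

theorem card_filter_even_range (n : ℕ) :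
    ((Finset.range (2 * n)).filter fun a => 2 ∣ a).card = n := by
  induction n with
  | zero => simp
  | succ n ih =>
    rw [mul_add, mul_one, Finset.range_add_one, Finset.filter_insert, Finset.range_add_one,
      Finset.filter_insert, if_neg (by omega), if_pos (by omega), Finset.card_insert_of_notMem, ih]
    simp

theorem cyclicClassNumber_semidihedral {G : Type*} [Group G] [Finite G] {e : ℕ} (he : 3 ≤ e)
    (f : G ≃* SemidihedralGroup e) : cyclicClassNumber G 2 = 1 + 2 ^ (e - 1) ∧
      cyclicClassNumber G 4 = 1 + 2 ^ (e - 2) ∧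
      ∀ j, 3 ≤ j → j ≤ e → cyclicClassNumber G (2 ^ j) = 1 := by
  have h := (SemidihedralGroup.isCyclicByTwo e he).map f.symm
  obtain ⟨d, rfl⟩ : ∃ d, e = d + 2 := ⟨e - 2, by omega⟩
  rw [show d + 2 - 1 = d + 1 from rfl, show d + 2 - 2 = d from rfl] at *
  have h4 : 4 ∣ 2 ^ (d + 2) := pow_dvd_pow 2 (show 2 ≤ d + 2 by omega)
  have hv : ((2 ^ (d + 2) : ℕ) : ℤ) ∣ 2 * (-1 + 2 ^ (d + 1) + 1) := by
    push_cast; exact ⟨1, by ring⟩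
  have hiff (a : ℕ) : ((2 ^ (d + 2) : ℕ) : ℤ) ∣ 0 + (-1 + 2 ^ (d + 1) + 1) * a ↔ 2 ∣ a := by
    rw [show (0 + (-1 + 2 ^ (d + 1) + 1) * a : ℤ) = ((2 ^ (d + 1) * a : ℕ) : ℤ) by push_cast; ring,
      Int.natCast_dvd_natCast, pow_succ 2 (d + 1)]
    exact Nat.mul_dvd_mul_iff_left (by positivity)
  have hc : ((Finset.range (2 ^ (d + 2))).filter fun a => 2 ∣ a).card = 2 ^ (d + 1) := by
    rw [pow_succ' 2 (d + 1)]; exact card_filter_even_range _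
  refine ⟨?_, ?_, fun j hj hje => ?_⟩
  · rw [h.cyclicClassNumber_two (dvd_trans (by norm_num) h4)]
    simp only [hiff, hc]
  · have := h.cyclicClassNumber_four h4 (by simp) hv
    simp only [hiff] at this
    have h5 := Finset.card_filter_add_card_filter_not (s := Finset.range (2 ^ (d + 2)))
      (fun a => 2 ∣ a)
    rw [hc, Finset.card_range] at h5
    have h6 : 2 ^ (d + 1) = 2 * 2 ^ d := pow_succ' 2 d
    have h7 : 2 ^ (d + 2) = 2 * 2 ^ (d + 1) := pow_succ' 2 (d + 1)
    omega
  · exact h.cyclicClassNumber_eq_one (pow_dvd_pow 2 hje) (by simp) hv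
        (two_pow_ne_two (by omega)) (two_pow_ne_four (by omega))

/-! ### Elements of order `p` outside a maximal cyclic subgroup -/

theorem mul_zpow_pow_eq {G : Type*} [Group G] {g x : G} {u : ℤ} (h : g⁻¹ * x * g = x ^ u) (s : ℤ)
    (k : ℕ) : (g * x ^ s) ^ k = g ^ k * x ^ (s * ∑ i ∈ Finset.range k, u ^ i) := by
  induction k with
  | zero => simp
  | succ k ih =>
    rw [pow_succ, ih, geom_sum_succ, mul_add, zpow_add, mul_one, mul_left_comm s u,
      ← conj_zpow_eq h, pow_succ]
    group

theorem conj_pow_zpow {G : Type*} [Group G] {g x : G} {u : ℤ} (h : g⁻¹ * x * g = x ^ u)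
    (m : ℕ) : (g ^ m)⁻¹ * x * g ^ m = x ^ u ^ m := by
  induction m with
  | zero => simp
  | succ m ih =>
    rw [pow_succ' u, ← conj_zpow_eq h, ← ih, pow_succ]
    group

/-- The geometric sum is `p` times a unit modulo powers of `p`. For `p = 2` the sum is `1 + u`, and
congruence modulo `4` is needed: `u = 3` gives `4`. -/
theorem exists_geom_sum_eq {p : ℕ} (hp : p.Prime) {u : ℤ} (hu : (p : ℤ) ∣ u - 1)
    (h4 : p = 2 → 4 ∣ u - 1) : ∃ q : ℤ, ∑ i ∈ Finset.range p, u ^ i = p * (1 + p * q) := by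
  rcases hp.eq_two_or_odd' with rfl | ho
  · obtain ⟨q, hq⟩ := h4 rfl
    refine ⟨q, ?_⟩
    rw [Finset.sum_range_succ, Finset.sum_range_one]
    push_cast
    linarith
  · obtain ⟨b, hb⟩ := hu
    obtain ⟨q, hq⟩ := odd_sq_dvd_geom_sum₂_sub (1 : ℤ) b ho
    refine ⟨q, ?_⟩
    obtain rfl : u = 1 + p * b := by linarith
    simp only [one_pow, mul_one] at hq
    linear_combination hq

theorem exists_mul_zpow_pow_eq_one {G : Type*} [Group G] {p n : ℕ} (hp : p.Prime) {g x : G}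
    {u t : ℤ} (hx : x ^ p ^ n = 1) (h : g⁻¹ * x * g = x ^ u) (hu : (p : ℤ) ∣ u - 1)
    (h4 : p = 2 → 4 ∣ u - 1) (ht : g ^ p = x ^ (p * t)) : ∃ s : ℤ, (g * x ^ s) ^ p = 1 := by
  obtain ⟨q, hq⟩ := exists_geom_sum_eq hp hu h4
  have hc : IsCoprime (1 + p * q : ℤ) ((p : ℤ) ^ n) :=
    IsCoprime.pow_right ⟨1, -q, by ring⟩
  obtain ⟨a, b, hab⟩ := hc
  -- Here `a` inverts `1 + p * q` modulo `p ^ n`, so this solves `t + s * (1 + p * q) ≡ 0`.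
  refine ⟨-t * a, ?_⟩
  rw [mul_zpow_pow_eq h, hq, ht, ← zpow_add,
    show (p * t + -t * a * (p * (1 + p * q)) : ℤ) = ((p ^ n : ℕ) : ℤ) * (p * t * b) by
      push_cast; linear_combination (-p * t) * hab,
    zpow_mul, zpow_natCast, hx, one_zpow]

section

variable {p : ℕ} [hp : Fact p.Prime] {G : Type*} [Group G]

/-- Some `g ^ p ^ k` is trivial, so `u ^ p ^ k ≡ 1` modulo `p`, and Fermat reduces the power to `u`.
-/
theorem IsPGroup.dvd_sub_one (hG : IsPGroup p G) {g x : G} {u : ℤ} (hx : x ≠ 1)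
    (h : g⁻¹ * x * g = x ^ u) : (p : ℤ) ∣ u - 1 := by
  obtain ⟨k, hk⟩ := hG g
  have h1 := conj_pow_zpow h (p ^ k)
  rw [hk] at h1
  simp only [inv_one, one_mul, mul_one] at h1
  have h2 : x ^ (u ^ p ^ k - 1) = 1 := by rw [zpow_sub, ← h1, zpow_one, mul_inv_cancel]
  rw [← orderOf_dvd_iff_zpow_eq_one] at h2
  have h3 := (Int.natCast_dvd_natCast.2 (hG.dvd_orderOf hx)).trans h2
  rw [← CharP.intCast_eq_zero_iff (ZMod p) p] at h3 ⊢
  push_cast at h3 ⊢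
  rwa [ZMod.pow_card_pow] at h3

theorem orderOf_dvd_sub_one {G : Type*} [Group G] {g x d : G} {u : ℤ} (h : g⁻¹ * x * g = x ^ u)
    (hd : d ∈ Subgroup.zpowers x) (hgd : Commute g d) : (orderOf d : ℤ) ∣ u - 1 := by
  obtain ⟨b, rfl⟩ := hd
  have h1 := conj_zpow_eq h b
  simp only at hgd
  rw [mul_assoc, ← hgd.eq, inv_mul_cancel_left, mul_comm, zpow_mul] at h1
  rw [orderOf_dvd_iff_zpow_eq_one, zpow_sub, ← h1, zpow_one, mul_inv_cancel]

/-- If `⟨x⟩` is a maximal cyclic subgroup and is normalized by an element outside of it, then it is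
normalized by an element of order `p` outside of it. -/
theorem IsPGroup.exists_pow_eq_one_notMem_zpowers (hG : IsPGroup p G) {x g : G} (hx : x ≠ 1)
    (hmax : ∀ w, x ∈ Subgroup.zpowers w → w ∈ Subgroup.zpowers x) (hg : g ∉ Subgroup.zpowers x)
    (hgx : g⁻¹ * x * g ∈ Subgroup.zpowers x)
    (h4 : p = 2 → ∃ d ∈ Subgroup.zpowers x, orderOf d = 4 ∧ Commute g d) :
    ∃ (g' : G) (u : ℤ), g' ∉ Subgroup.zpowers x ∧ g' ^ p = 1 ∧ g'⁻¹ * x * g' = x ^ u ∧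
      (p : ℤ) ∣ u - 1 ∧ (p = 2 → 4 ∣ u - 1) := by
  classical
  obtain ⟨u₀, hu₀⟩ := hgx
  have hex : ∃ j, g ^ p ^ j ∈ Subgroup.zpowers x := by
    obtain ⟨k, hk⟩ := hG g
    exact ⟨k, hk ▸ Subgroup.one_mem _⟩
  -- Take the last term of `g, g ^ p, g ^ p ^ 2, …` outside `⟨x⟩`.
  obtain ⟨m, hm1, hm2⟩ : ∃ m, g ^ m ∉ Subgroup.zpowers x ∧ (g ^ m) ^ p ∈ Subgroup.zpowers x := by
    have h0 : Nat.find hex ≠ 0 := by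
      intro h0
      have := Nat.find_spec hex
      rw [h0, pow_zero, pow_one] at this
      exact hg this
    obtain ⟨j, hj⟩ := Nat.exists_eq_succ_of_ne_zero h0
    refine ⟨p ^ j, Nat.find_min hex (by omega), ?_⟩
    have := Nat.find_spec hex
    rwa [hj, pow_succ, pow_mul] at this
  have hu := conj_pow_zpow hu₀.symm m
  set u := u₀ ^ m
  have hpu := hG.dvd_sub_one hx hu
  have h4u : p = 2 → 4 ∣ u - 1 := by
    intro h2
    obtain ⟨d, hd, hd4, hgd⟩ := h4 h2
    have := orderOf_dvd_sub_one hu hd (hgd.pow_left m)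
    rwa [hd4] at this
  obtain ⟨a, ha⟩ := hm2
  -- Otherwise `x` would be a power of `g ^ m`, against maximality of `⟨x⟩`.
  have hpa : (p : ℤ) ∣ a := by
    by_contra hpa
    have hc : IsCoprime a (orderOf x : ℤ) := by
      obtain ⟨k, hk⟩ := (IsPGroup.iff_orderOf.1 hG) x
      rw [hk, Nat.cast_pow]
      exact IsCoprime.pow_right ((Nat.prime_iff_prime_int.1 hp.out).coprime_iff_not_dvd.2 hpa).symm
    obtain ⟨b, c, hbc⟩ := hc
    refine hm1 (hmax _ ⟨p * b, ?_⟩)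
    have ha' : x ^ a = (g ^ m) ^ p := ha
    simp only
    rw [zpow_mul, zpow_natCast, ← ha', ← zpow_mul, mul_comm, eq_sub_of_add_eq hbc, zpow_sub,
      mul_comm c, zpow_mul, zpow_natCast, pow_orderOf_eq_one]
    simp
  obtain ⟨t, rfl⟩ := hpa
  obtain ⟨n, hn⟩ := hG x
  obtain ⟨s, hs⟩ := exists_mul_zpow_pow_eq_one hp.out hn hu hpu h4u ha.symm
  refine ⟨g ^ m * x ^ s, u, fun h => hm1 ?_, hs, ?_, hpu, h4u⟩
  · exact (Subgroup.mul_mem_cancel_right _ (Subgroup.zpow_mem_zpowers x s)).1 h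
  · rw [show (g ^ m * x ^ s)⁻¹ * x * (g ^ m * x ^ s) =
      (x ^ s)⁻¹ * ((g ^ m)⁻¹ * x * g ^ m) * x ^ s by group, hu]
    group

theorem orderOf_pow_prime_pow_sub {G : Type*} [Group G] {c : G} {p i j : ℕ} (hp : p.Prime)
    (hc : orderOf c = p ^ i) (hj : j ≤ i) : orderOf (c ^ p ^ (i - j)) = p ^ j := by
  rw [orderOf_pow_of_dvd (pow_ne_zero _ hp.ne_zero) (hc ▸ pow_dvd_pow p (Nat.sub_le i j)), hc,
    Nat.pow_div (Nat.sub_le i j) hp.pos, Nat.sub_sub_self hj]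

theorem mem_zpowers_of_mem_zpowers_of_orderOf_le {G : Type*} [Group G] [Finite G] {x w : G}
    (h : x ∈ Subgroup.zpowers w) (ho : orderOf w ≤ orderOf x) : w ∈ Subgroup.zpowers x := by
  rw [Subgroup.eq_of_le_of_card_ge (Subgroup.zpowers_le.2 h)
    (by rwa [Nat.card_zpowers, Nat.card_zpowers])]
  exact Subgroup.mem_zpowers w

/-! ### The criterion for being cyclic or having a cyclic subgroup of index two -/

theorem IsPGroup.isCyclic_of_central [Finite G] (hG : IsPGroup p G) {c : G} {i : ℕ} (hi : 2 ≤ i)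
    (hc : orderOf c = p ^ i) (hcen : ∀ g, Commute g c)
    (h : ∀ g : G, g ^ p = 1 → g ∈ Subgroup.zpowers c) : IsCyclic G := by
  obtain ⟨x, hcx, hmax⟩ := Set.exists_max_image {x : G | c ∈ Subgroup.zpowers x} orderOf
    (Set.toFinite _) ⟨c, Subgroup.mem_zpowers c⟩
  rw [Set.mem_ofPred_eq] at hcx
  have hle : Subgroup.zpowers c ≤ Subgroup.zpowers x := Subgroup.zpowers_le.2 hcx
  rw [isCyclic_iff_exists_zpowers_eq_top]
  refine ⟨x, ?_⟩
  by_contra hne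
  have := hG.isNilpotent
  -- Normalizers grow in a nilpotent group, which supplies an outside element normalizing `⟨x⟩`.
  have hlt := Group.normalizerCondition_of_isNilpotent _ (lt_top_iff_ne_top.2 hne)
  obtain ⟨g, hgn, hgx⟩ := SetLike.exists_of_lt hlt
  have hx : x ≠ 1 := by
    rintro rfl
    rw [Subgroup.zpowers_one_eq_bot, Subgroup.mem_bot] at hcx
    rw [hcx, orderOf_one] at hc
    exact (Nat.one_lt_pow (by omega) hp.out.one_lt).ne hc
  obtain ⟨g', u, h1, h2, -⟩ := hG.exists_pow_eq_one_notMem_zpowers hx (fun w hw =>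
      mem_zpowers_of_mem_zpowers_of_orderOf_le hw (hmax w (Subgroup.zpowers_le.2 hw hcx))) hgx
    (by
      have := (Subgroup.mem_normalizer_iff.1 (Subgroup.inv_mem _ hgn) x).1 (Subgroup.mem_zpowers x)
      simpa using this)
    (fun h2 => ⟨c ^ p ^ (i - 2), hle (Subgroup.npow_mem_zpowers c _), by
      rw [orderOf_pow_prime_pow_sub hp.out hc hi, h2]; rfl, (hcen g).pow_right _⟩)
  exact h1 (hle (h g' h2))

theorem IsPGroup.isCyclic_or_isCyclicByTwo [Finite G] (hG : IsPGroup p G) {c : G} {i : ℕ} (hi : 2 ≤ i)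
    (hc : orderOf c = p ^ i) (hn : ∀ g, g⁻¹ * c * g ∈ Subgroup.zpowers c)
    (h : ∀ (g : G) (u : ℤ), g ^ p = 1 → g⁻¹ * c * g = c ^ u → (p : ℤ) ∣ u - 1 →
      (p = 2 → 4 ∣ u - 1) → g ∈ Subgroup.zpowers c) :
    IsCyclic G ∨ (p = 2 ∧ ∃ (x y : G) (n : ℕ) (v k : ℤ), 2 ≤ n ∧ v % 4 = 3 ∧
      IsCyclicByTwo x y (2 ^ n) v k) := by
  let H := Subgroup.centralizer {c}
  have hcH : c ∈ H := by simp [H, Subgroup.mem_centralizer_singleton_iff]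
  have hH : IsCyclic H := by
    refine (hG.to_subgroup H).isCyclic_of_central (c := ⟨c, hcH⟩) hi (by simpa using hc) ?_ ?_
    · rintro ⟨g, hg⟩
      exact Subtype.ext (Subgroup.mem_centralizer_singleton_iff.1 hg)
    · rintro ⟨g, hg⟩ hgp
      have hgc := Subgroup.mem_centralizer_singleton_iff.1 hg
      obtain ⟨a, ha⟩ := h g 1 (by simpa using congrArg Subtype.val hgp)
        (by rw [zpow_one, mul_assoc, ← hgc, inv_mul_cancel_left]) (by simp) (by simp)
      exact ⟨a, Subtype.ext (by simpa using ha)⟩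
  obtain ⟨x₀, hx₀⟩ := isCyclic_iff_exists_zpowers_eq_top.1 hH
  set x : G := (x₀ : G)
  have hmem (g : G) : g ∈ Subgroup.zpowers x ↔ Commute g c := by
    constructor
    · rintro ⟨a, rfl⟩
      exact Commute.zpow_left (Subgroup.mem_centralizer_singleton_iff.1 x₀.2) a
    · intro hg
      have : (⟨g, Subgroup.mem_centralizer_singleton_iff.2 hg⟩ : H) ∈ Subgroup.zpowers x₀ := by
        rw [hx₀]; trivial
      obtain ⟨a, ha⟩ := this
      exact ⟨a, by simpa using congrArg Subtype.val ha⟩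
  have hcx : c ∈ Subgroup.zpowers x := (hmem c).2 (Commute.refl c)
  have hle : Subgroup.zpowers c ≤ Subgroup.zpowers x := Subgroup.zpowers_le.2 hcx
  -- `⟨x⟩` is the centralizer of the normal subgroup `⟨c⟩`, hence normal.
  have hxn (g : G) : g⁻¹ * x * g ∈ Subgroup.zpowers x := by
    rw [hmem]
    obtain ⟨a, ha⟩ := hn g⁻¹
    have h1 : Commute x (g * c * g⁻¹) := by
      rw [inv_inv] at ha
      rw [← ha]
      exact ((hmem x).1 (Subgroup.mem_zpowers x)).zpow_right a
    rw [Commute, SemiconjBy] at h1 ⊢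
    calc g⁻¹ * x * g * c = g⁻¹ * (x * (g * c * g⁻¹)) * g := by group
      _ = c * (g⁻¹ * x * g) := by rw [h1]; group
  have hx : x ≠ 1 := by
    intro h1
    rw [h1, Subgroup.zpowers_one_eq_bot, Subgroup.mem_bot] at hcx
    rw [hcx, orderOf_one] at hc
    exact (Nat.one_lt_pow (by omega) hp.out.one_lt).ne hc
  -- `⟨x⟩` is maximal cyclic: if `x ∈ ⟨w⟩`, then `c ∈ ⟨w⟩`, so `w` centralizes `c`.
  have key (g : G) (hg : p = 2 → Commute g (c ^ p ^ (i - 2))) : g ∈ Subgroup.zpowers x := by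
    by_contra hgx
    obtain ⟨g', u, h1, h2, h3, h4, h5⟩ := hG.exists_pow_eq_one_notMem_zpowers hx (fun w hw => by
        rw [hmem]
        obtain ⟨b, hb⟩ := Subgroup.zpowers_le.2 hw hcx
        rw [← hb]
        exact (Commute.refl w).zpow_right b) hgx (hxn g)
      (fun h2 => ⟨c ^ p ^ (i - 2), hle (Subgroup.npow_mem_zpowers c _), by
        rw [orderOf_pow_prime_pow_sub hp.out hc hi, h2]; rfl, hg h2⟩)
    refine h1 (hle (h g' u h2 ?_ h4 h5))
    obtain ⟨b, hb⟩ := hcx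
    have := conj_zpow_eq h3 b
    rw [mul_comm, zpow_mul] at this
    rw [← hb]
    exact this
  by_cases htop : Subgroup.zpowers x = ⊤
  · exact Or.inl (isCyclic_iff_exists_zpowers_eq_top.2 ⟨x, htop⟩)
  right
  obtain ⟨y, -, hy⟩ := SetLike.exists_of_lt (lt_top_iff_ne_top.2 htop)
  have hp2 : p = 2 := by
    by_contra hp2
    exact hy (key y fun h2 => absurd h2 hp2)
  subst hp2
  set d := c ^ 2 ^ (i - 2) with hd
  have hd4 : orderOf d = 4 := orderOf_pow_prime_pow_sub hp.out hc hi
  have hdx : d ∈ Subgroup.zpowers x := hle (Subgroup.npow_mem_zpowers c _)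
  -- By `key`, an outside element cannot commute with `d`, so the odd exponent `u` is `3` modulo
  -- `4`.
  have hinv (g : G) (hg : g ∉ Subgroup.zpowers x) (u : ℤ) (hu : g⁻¹ * x * g = x ^ u) :
      u % 4 = 3 ∧ g⁻¹ * d * g = d⁻¹ := by
    have h2 := hG.dvd_sub_one hx hu
    have h1 : g⁻¹ * d * g = d ^ u := by
      obtain ⟨b, hb⟩ := hdx
      have := conj_zpow_eq hu b
      rw [mul_comm, zpow_mul] at this
      rw [← hb]
      exact this
    have h3 : ¬ (4 : ℤ) ∣ u - 1 := by
      intro h4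
      refine hg (key g fun _ => ?_)
      have : d ^ u = d := by
        rw [← sub_add_cancel u 1, zpow_add_one, orderOf_dvd_iff_zpow_eq_one.1 (by rwa [hd4]),
          one_mul]
      rw [this, mul_assoc, inv_mul_eq_iff_eq_mul] at h1
      exact h1.symm
    refine ⟨by omega, ?_⟩
    rw [h1, ← zpow_neg_one, zpow_eq_zpow_iff_modEq, hd4]
    change u % 4 = -1 % 4
    omega
  obtain ⟨v, hv⟩ := hxn y
  have hv' := hv.symm
  obtain ⟨hv4, hyd⟩ := hinv y hy v hv'
  -- Both `y` and `g` invert `d`, so `y⁻¹ * g` centralizes it and `key` applies; this yields index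
  -- two.
  have hout (g : G) (hg : g ∉ Subgroup.zpowers x) : y⁻¹ * g ∈ Subgroup.zpowers x := by
    refine key _ fun _ => ?_
    obtain ⟨u, hu⟩ := hxn g
    have h1 := (hinv g hg u hu.symm).2
    rw [mul_assoc, inv_mul_eq_iff_eq_mul] at hyd h1
    have h2 : d * y⁻¹ = y⁻¹ * d⁻¹ := by
      have := congrArg (·⁻¹) hyd
      simpa using this.symm
    change y⁻¹ * g * d = d * (y⁻¹ * g)
    rw [← mul_assoc, h2, mul_assoc, mul_assoc]
    congr 1
    rw [eq_inv_mul_iff_mul_eq, ← mul_assoc, h1]; group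
  obtain ⟨k, hk⟩ : y ^ 2 ∈ Subgroup.zpowers x := by
    by_contra hyy
    have := hout _ hyy
    rw [pow_two, inv_mul_cancel_left] at this
    exact hy this
  obtain ⟨n, hxo⟩ := (IsPGroup.iff_orderOf.1 hG) x
  refine ⟨rfl, x, y, n, v, k, ?_, hv4, hxo, hy, fun g => ?_, hv', hk.symm⟩
  · have h1 : 2 ^ i ∣ 2 ^ n := by
      rw [← hc, ← hxo, ← Nat.card_zpowers c, ← Nat.card_zpowers x]
      exact Subgroup.card_dvd_of_le hle
    exact hi.trans ((Nat.pow_dvd_pow_iff_le_right one_lt_two).1 h1)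
  · by_cases hg : g ∈ Subgroup.zpowers x
    · obtain ⟨a, ha⟩ := hg
      exact ⟨a, Or.inl ha.symm⟩
    · obtain ⟨a, ha⟩ := hout g hg
      exact ⟨a, Or.inr (by rw [← inv_mul_eq_iff_eq_mul]; exact ha.symm)⟩

end

/-! ### Reduction of the structure constants to the three families -/

namespace IsCyclicByTwo

variable {G : Type*} [Group G] {x y : G} {N n : ℕ} {v k : ℤ}

/-- This change of generator will absorb the nontrivial value of `k` in the semidihedral case. -/
theorem mul_right (h : IsCyclicByTwo x y N v k) : IsCyclicByTwo x (y * x) N v (k + v + 1) where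
  orderOf_eq := h.orderOf_eq
  notMem := by simpa using h.mul_zpow_notMem 1
  exists_eq g := by
    obtain ⟨a, rfl | rfl⟩ := h.exists_eq g
    · exact ⟨a, Or.inl rfl⟩
    · exact ⟨a - 1, Or.inr (by group)⟩
  conj := by
    rw [show (y * x)⁻¹ * x * (y * x) = x⁻¹ * (y⁻¹ * x * y) * x by group, h.conj]
    group
  sq := by simpa [pow_two] using h.mul_zpow_mul_mul_zpow 1 1

/-- `y` commutes with `y ^ 2 = x ^ k`, so `v * k ≡ k`; `y ^ 2` commutes with `x`, so `v ^ 2 ≡ 1`. As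
`v - 1` is twice an odd number, the odd factor cancels. -/
theorem dvd_two_mul (h : IsCyclicByTwo x y (2 ^ n) v k) (hv : v % 4 = 3) :
    ((2 ^ n : ℕ) : ℤ) ∣ 2 * k ∧ ((2 ^ n : ℕ) : ℤ) ∣ 2 * (v + 1) := by
  obtain ⟨w, hw⟩ : ∃ w, v = 1 + 2 * (1 + 2 * w) := ⟨v / 4, by omega⟩
  have hc : IsCoprime ((2 ^ n : ℕ) : ℤ) (1 + 2 * w) := by
    push_cast
    exact IsCoprime.pow_left ⟨-w, 1, by ring⟩
  constructor
  · have h1 := conj_zpow_eq h.conj k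
    rw [← h.sq, show y⁻¹ * y ^ 2 * y = y ^ 2 by group, h.sq, h.zpow_eq_iff] at h1
    have h2 := h1.dvd
    rw [show v * k - k = (1 + 2 * w) * (2 * k) by rw [hw]; ring] at h2
    exact hc.dvd_of_dvd_mul_left h2
  · have h1 := conj_pow_zpow h.conj 2
    rw [h.sq, mul_assoc, (Commute.refl x).zpow_right k, inv_mul_cancel_left] at h1
    nth_rw 1 [← zpow_one x] at h1
    have h2 := ((h.zpow_eq_iff _ _).1 h1).dvd
    rw [show v ^ 2 - 1 = (1 + 2 * w) * (2 * (v + 1)) by rw [hw]; ring] at h2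
    exact hc.dvd_of_dvd_mul_left h2

theorem nonempty_mulEquiv_of_mod_four (h : IsCyclicByTwo x y (2 ^ n) v k) (hn : 2 ≤ n)
    (hv : v % 4 = 3) : Nonempty (G ≃* DihedralGroup (2 ^ n)) ∨
      Nonempty (G ≃* QuaternionGroup (2 ^ (n - 1))) ∨
      (3 ≤ n ∧ Nonempty (G ≃* SemidihedralGroup n)) := by
  obtain ⟨hk, hv2⟩ := h.dvd_two_mul hv
  have hmod (a : ℤ) (ha : ((2 ^ n : ℕ) : ℤ) ∣ 2 * a) :
      a ≡ 0 [ZMOD (2 ^ n : ℕ)] ∨ a ≡ 2 ^ (n - 1) [ZMOD (2 ^ n : ℕ)] := by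
    obtain ⟨m, rfl⟩ : ∃ m, n = m + 1 := ⟨n - 1, by omega⟩
    obtain ⟨q, hq⟩ := ha
    have h1 : a = 2 ^ m * q := by push_cast at hq; rw [pow_succ] at hq; linarith
    rw [Nat.add_sub_cancel, h1]
    push_cast
    rcases Int.even_or_odd' q with ⟨r, rfl | rfl⟩
    · exact Or.inl ((Int.modEq_zero_iff_dvd).2 ⟨r, by ring⟩)
    · exact Or.inr ((Int.modEq_iff_dvd).2 ⟨-r, by ring⟩)
  rcases hmod _ hv2 with hv0 | hv1
  · have hv0' : v ≡ -1 [ZMOD (2 ^ n : ℕ)] := by simpa using hv0.sub_right 1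
    rcases hmod _ hk with hk0 | hk1
    · exact Or.inl ((h.of_modEq hv0' hk0).nonempty_mulEquiv (DihedralGroup.isCyclicByTwo _))
    · have h' : IsCyclicByTwo x y (2 * 2 ^ (n - 1)) (-1) (2 ^ (n - 1) : ℕ) := by
        rw [← pow_succ', Nat.sub_add_cancel (by omega), Nat.cast_pow]
        exact h.of_modEq hv0' hk1
      exact Or.inr (Or.inl (h'.nonempty_mulEquiv (QuaternionGroup.isCyclicByTwo _)))
  · have hv1' : v ≡ -1 + 2 ^ (n - 1) [ZMOD (2 ^ n : ℕ)] := by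
      rw [neg_add_eq_sub]
      simpa using hv1.sub_right 1
    -- For `n = 2` the exponent `-1 + 2` is `1`, contradicting `v % 4 = 3`.
    have hn3 : 3 ≤ n := by
      by_contra hlt
      obtain rfl : n = 2 := by omega
      have : v % 4 = 1 := hv1'
      omega
    refine Or.inr (Or.inr ⟨hn3, ?_⟩)
    rcases hmod _ hk with hk0 | hk1
    · exact (h.of_modEq hv1' hk0).nonempty_mulEquiv (SemidihedralGroup.isCyclicByTwo n hn3)
    · refine (h.mul_right.of_modEq hv1' ?_).nonempty_mulEquiv
        (SemidihedralGroup.isCyclicByTwo n hn3)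
      rw [add_assoc]
      refine (hk1.add hv1).trans ((Int.modEq_zero_iff_dvd).2 ⟨1, ?_⟩)
      rw [← two_mul, ← pow_succ', Nat.sub_add_cancel (by omega)]
      simp

end IsCyclicByTwo

/-! ### From a unique cyclic subgroup to the criterion -/

section

variable {p : ℕ} [hp : Fact p.Prime] {G : Type*} [Group G]

theorem conj_mem_zpowers_of_unique {c : G}
    (hc : ∀ g : G, orderOf g = orderOf c → Subgroup.zpowers g = Subgroup.zpowers c) (g : G) :
    g⁻¹ * c * g ∈ Subgroup.zpowers c := by
  rw [← hc (g⁻¹ * c * g)]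
  · exact Subgroup.mem_zpowers _
  · simpa using orderOf_injective (MulAut.conj g⁻¹).toMonoidHom (MulAut.conj g⁻¹).injective c

/-- An element of order `p` that acts on `⟨c⟩` as the identity modulo `p` (modulo `4` if `p = 2`)
multiplies `c` to an element of the same order. -/
theorem orderOf_mul_eq_of_conj {c g : G} {i : ℕ} {u : ℤ} (hi : 2 ≤ i) (hc : orderOf c = p ^ i)
    (hg : g ^ p = 1) (h : g⁻¹ * c * g = c ^ u) (hu : (p : ℤ) ∣ u - 1) (h4 : p = 2 → 4 ∣ u - 1) :
    orderOf (g * c) = p ^ i := by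
  obtain ⟨q, hq⟩ := exists_geom_sum_eq hp.out hu h4
  -- Since `1 + p * q` is prime to `p`, this power has the same order as `c ^ p`.
  have hpow : (g * c) ^ p = c ^ ((p : ℤ) * (1 + p * q)) := by
    have := mul_zpow_pow_eq h 1 p
    rwa [zpow_one, hg, one_mul, one_mul, hq] at this
  obtain ⟨j, rfl⟩ : ∃ j, i = j + 2 := ⟨i - 2, by omega⟩
  have hpp : (p : ℤ) ≠ 0 := by exact_mod_cast hp.out.ne_zero
  refine orderOf_eq_prime_pow (n := j + 1) ?_ ?_
  · rw [pow_succ', pow_mul, hpow, ← zpow_natCast, ← zpow_mul, ← orderOf_dvd_iff_zpow_eq_one, hc]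
    rintro ⟨b, hb⟩
    push_cast at hb
    have h1 : (p : ℤ) ^ (j + 1) * (1 + p * q) = p ^ (j + 1) * (p * b) := by
      rw [← sub_eq_zero]; linear_combination hb
    have h2 := mul_left_cancel₀ (pow_ne_zero _ hpp) h1
    have h3 : (p : ℤ) ∣ 1 := ⟨b - q, by linear_combination h2⟩
    exact hp.out.one_lt.ne' (Nat.dvd_one.1 (Int.natCast_dvd_natCast.1 (by simpa using h3)))
  · rw [pow_succ', pow_mul, hpow, ← zpow_natCast, ← zpow_mul, ← orderOf_dvd_iff_zpow_eq_one, hc]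
    push_cast
    exact ⟨1 + p * q, by ring⟩

theorem IsPGroup.isCyclic_or_isCyclicByTwo_of_unique_two_le [Finite G] (hG : IsPGroup p G) {c : G}
    {i : ℕ} (hi : 2 ≤ i) (hc : orderOf c = p ^ i)
    (huniq : ∀ g : G, orderOf g = p ^ i → Subgroup.zpowers g = Subgroup.zpowers c) :
    IsCyclic G ∨ (p = 2 ∧ ∃ (x y : G) (n : ℕ) (v k : ℤ), 2 ≤ n ∧ v % 4 = 3 ∧
      IsCyclicByTwo x y (2 ^ n) v k) := by
  refine hG.isCyclic_or_isCyclicByTwo hi hc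
    (conj_mem_zpowers_of_unique fun g hg => huniq g (hg.trans hc)) fun g u hg h hu h4 => ?_
  have h1 : g * c ∈ Subgroup.zpowers c := by
    rw [← huniq _ (orderOf_mul_eq_of_conj hi hc hg h hu h4)]
    exact Subgroup.mem_zpowers _
  exact (Subgroup.mul_mem_cancel_right _ (Subgroup.mem_zpowers c)).1 h1

theorem IsPGroup.isCyclic_or_isCyclicByTwo_of_unique_prime [Finite G] (hG : IsPGroup p G) {c : G}
    (hc : orderOf c = p)
    (huniq : ∀ g : G, orderOf g = p → Subgroup.zpowers g = Subgroup.zpowers c) :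
    IsCyclic G ∨ (p = 2 ∧ ∃ (x y : G) (n : ℕ) (v k : ℤ), 2 ≤ n ∧ v % 4 = 3 ∧
      IsCyclicByTwo x y (2 ^ n) v k) := by
  have hconj := conj_mem_zpowers_of_unique (c := c) fun g hg => huniq g (hg.trans hc)
  have hZ : (Subgroup.zpowers c).Normal := by
    refine ⟨?_⟩
    rintro _ ⟨a, rfl⟩ g
    have := Subgroup.zpow_mem _ (hconj g⁻¹) a
    have h2 := conj_zpow (i := a) (a := g) (b := c)
    rw [inv_inv, h2] at this
    exact this
  have hone (g : G) (hg : g ^ p = 1) : g ∈ Subgroup.zpowers c := by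
    by_cases h1 : g = 1
    · rw [h1]; exact Subgroup.one_mem _
    · rw [← huniq g (orderOf_eq_prime hg h1)]; exact Subgroup.mem_zpowers g
  by_cases htop : Subgroup.zpowers c = ⊤
  · exact Or.inl (isCyclic_iff_exists_zpowers_eq_top.2 ⟨c, htop⟩)
  have hnt : Nontrivial (G ⧸ Subgroup.zpowers c) := QuotientGroup.nontrivial_iff.2 htop
  have hQ := hG.to_quotient (Subgroup.zpowers c)
  have := hQ.center_nontrivial
  -- Centrality of the image of `g` modulo `⟨c⟩` will make `⟨g⟩` normal once `⟨c⟩ ≤ ⟨g⟩`.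
  obtain ⟨⟨q, hqc⟩, hq⟩ := exists_prime_orderOf_dvd_card' (G := Subgroup.center _) p
    (((hQ.to_subgroup (Subgroup.center _)).card_eq_or_dvd).resolve_left Finite.one_lt_card.ne')
  rw [Subgroup.orderOf_mk] at hq
  obtain ⟨g, rfl⟩ := QuotientGroup.mk_surjective q
  have hgc : g ∉ Subgroup.zpowers c := by
    intro hg
    rw [(QuotientGroup.eq_one_iff g).2 hg, orderOf_one] at hq
    exact hp.out.one_lt.ne hq
  have hgp : g ^ p ∈ Subgroup.zpowers c := by
    rw [← QuotientGroup.eq_one_iff, QuotientGroup.mk_pow, ← hq, pow_orderOf_eq_one]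
  have hgp1 : g ^ p ≠ 1 := fun h => hgc (hone g h)
  have hgpp : (g ^ p) ^ p = 1 := by
    have := orderOf_dvd_of_mem_zpowers hgp
    rwa [hc, orderOf_dvd_iff_pow_eq_one] at this
  have hle : Subgroup.zpowers c ≤ Subgroup.zpowers g := by
    rw [← huniq _ (orderOf_eq_prime hgpp hgp1), Subgroup.zpowers_le]
    exact Subgroup.npow_mem_zpowers g p
  refine hG.isCyclic_or_isCyclicByTwo (c := g) le_rfl
    (orderOf_eq_prime_pow (n := 1) (by rwa [pow_one]) (by rwa [pow_two, pow_mul])) (fun w => ?_)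
    fun w u hw _ _ _ => hle (hone w hw)
  have h1 : g⁻¹ * (w⁻¹ * g * w) ∈ Subgroup.zpowers c := by
    rw [← QuotientGroup.eq]
    have := Subgroup.mem_center_iff.1 hqc (w : G ⧸ Subgroup.zpowers c)
    rw [QuotientGroup.mk_mul, QuotientGroup.mk_mul, QuotientGroup.mk_inv, mul_assoc, ← this,
      inv_mul_cancel_left]
  exact (Subgroup.mul_mem_cancel_left _ (Subgroup.inv_mem _ (Subgroup.mem_zpowers g))).1 (hle h1)

/-- A finite `p`-group with a unique cyclic subgroup of order `p ^ i` for some `i ≥ 1` is cyclic or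
a `2`-group of maximal class. -/
theorem IsPGroup.isCyclic_or_of_cyclicClassNumber_eq_one [Finite G] (hG : IsPGroup p G) {e i : ℕ}
    (hexp : Monoid.exponent G = p ^ e) (hi : 1 ≤ i) (h : cyclicClassNumber G (p ^ i) = 1) :
    IsCyclic G ∨ (p = 2 ∧ 2 ≤ e ∧ (Nonempty (G ≃* DihedralGroup (2 ^ e)) ∨
      Nonempty (G ≃* QuaternionGroup (2 ^ (e - 1))) ∨
      (3 ≤ e ∧ Nonempty (G ≃* SemidihedralGroup e)))) := by
  obtain ⟨c, hc, huniq⟩ := exists_unique_zpowers_of_cyclicClassNumber_eq_one h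
  have key : IsCyclic G ∨ (p = 2 ∧ ∃ (x y : G) (n : ℕ) (v k : ℤ), 2 ≤ n ∧ v % 4 = 3 ∧
      IsCyclicByTwo x y (2 ^ n) v k) := by
    rcases hi.eq_or_lt with rfl | hi
    · simp only [pow_one] at hc huniq
      exact hG.isCyclic_or_isCyclicByTwo_of_unique_prime hc huniq
    · exact hG.isCyclic_or_isCyclicByTwo_of_unique_two_le hi hc huniq
  refine key.imp_right ?_
  rintro ⟨rfl, x, y, n, v, k, hn, hv, hxy⟩
  have hd := hxy.dvd_two_mul hv
  -- The exponent equals the order of `x`, which identifies `n` with `e`.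
  have := hxy.exponent_eq (pow_dvd_pow 2 hn) hd.1 hd.2
  rw [hexp] at this
  obtain rfl := Nat.pow_right_injective le_rfl this
  exact ⟨rfl, hn, hxy.nonempty_mulEquiv_of_mod_four hn hv⟩

end

/-- In the dihedral and quaternion cases the parameter of Mathlib's group is chosen so that the
group has order `2 ^ (e + 1)`: `DihedralGroup n` has order `2 * n` and `QuaternionGroup n` has
order `4 * n`. -/
theorem corollary2p4 (p : ℕ) [Fact p.Prime] (G : Type*) [Group G] [Finite G]
    (hG : IsPGroup p G) (e : ℕ) (he : 1 ≤ e) (hexp : Monoid.exponent G = p ^ e) :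
    ((∃ i, 1 ≤ i ∧ i ≤ e ∧ cyclicClassNumber G (p ^ i) = 1) ↔
      (Nonempty (G ≃* Multiplicative (ZMod (p ^ e))) ∨
        (p = 2 ∧
          ((2 ≤ e ∧ Nonempty (G ≃* DihedralGroup (2 ^ e))) ∨
           (2 ≤ e ∧ Nonempty (G ≃* QuaternionGroup (2 ^ (e - 1)))) ∨
           (3 ≤ e ∧ Nonempty (G ≃* SemidihedralGroup e)))))) ∧
    (Nonempty (G ≃* Multiplicative (ZMod (p ^ e))) →
      ∀ j, 1 ≤ j → j ≤ e → cyclicClassNumber G (p ^ j) = 1) ∧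
    (2 ≤ e → Nonempty (G ≃* DihedralGroup (2 ^ e)) →
      cyclicClassNumber G 2 = 1 + 2 ^ e ∧
      ∀ j, 2 ≤ j → j ≤ e → cyclicClassNumber G (2 ^ j) = 1) ∧
    (2 ≤ e → Nonempty (G ≃* QuaternionGroup (2 ^ (e - 1))) →
      cyclicClassNumber G 4 = 1 + 2 ^ (e - 1) ∧
      ∀ j, 1 ≤ j → j ≤ e → j ≠ 2 → cyclicClassNumber G (2 ^ j) = 1) ∧
    (3 ≤ e → Nonempty (G ≃* SemidihedralGroup e) →
      cyclicClassNumber G 2 = 1 + 2 ^ (e - 1) ∧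
      cyclicClassNumber G 4 = 1 + 2 ^ (e - 2) ∧
      ∀ j, 3 ≤ j → j ≤ e → cyclicClassNumber G (2 ^ j) = 1) := by
  have hcyc : Nonempty (G ≃* Multiplicative (ZMod (p ^ e))) →
      ∀ j, 1 ≤ j → j ≤ e → cyclicClassNumber G (p ^ j) = 1 := by
    rintro ⟨f⟩ j - hje
    have : IsCyclic G := isCyclic_of_surjective f.symm f.symm.surjective
    refine cyclicClassNumber_eq_one_of_isCyclic ?_
    rw [Nat.card_congr f.toEquiv, Nat.card_congr Multiplicative.toAdd, Nat.card_zmod]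
    exact pow_dvd_pow p hje
  refine ⟨⟨?_, ?_⟩, hcyc, ?_, ?_, ?_⟩
  · rintro ⟨i, hi, -, h⟩
    rcases hG.isCyclic_or_of_cyclicClassNumber_eq_one hexp hi h with hc | ⟨h2, he2, h⟩
    · rw [IsCyclic.exponent_eq_card] at hexp
      rw [← hexp]
      exact Or.inl ⟨(zmodCyclicMulEquiv hc).symm⟩
    · exact Or.inr ⟨h2, h.imp (⟨he2, ·⟩) (Or.imp_left (⟨he2, ·⟩))⟩
  · rintro (h | ⟨rfl, ⟨he2, ⟨f⟩⟩ | ⟨he2, ⟨f⟩⟩ | ⟨he3, ⟨f⟩⟩⟩)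
    · exact ⟨1, le_rfl, he, hcyc h 1 le_rfl he⟩
    · exact ⟨2, one_le_two, he2, (cyclicClassNumber_dihedral he2 f).2 2 le_rfl he2⟩
    · exact ⟨1, le_rfl, he, (cyclicClassNumber_quaternion he2 f).2 1 le_rfl he (by norm_num)⟩
    · exact ⟨3, by norm_num, he3, (cyclicClassNumber_semidihedral he3 f).2.2 3 le_rfl he3⟩
  · rintro he2 ⟨f⟩
    exact cyclicClassNumber_dihedral he2 f
  · rintro he2 ⟨f⟩
    exact cyclicClassNumber_quaternion he2 f
  · rintro he3 ⟨f⟩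
    exact cyclicClassNumber_semidihedral he3 f
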